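/- All graphs are finite and simple. A $(k_1,k_2)$-coloring of a graph is a partition of its vertex set into two classes, the first inducing a subgraph of maximum degree at most $k_1$ and the second inducing a subgraph of maximum degree at most $k_2$; for $k_1=0$ the vertices of the first class are said to be colored $0$. A graph is $(C_3,C_4,C_6)$-free if it contains no cycle of length $3$, $4$ or $6$. **The gadget $F_{x,y}$.** Its vertices are two terminals $x,y$ and the following vertices, where $1\le i\le 4$ and $1\le j\le 3$. On the side of $x$: white vertices $w_i$, big vertices $p_i$, and green vertices $u_i,g_i$. On the side of $y$: white vertices $w'_i$, big vertices $p'_i$, and green vertices $u'_i,g'_i$. Moreover there are nine pairs of adjacent red vertices, three for each $j$. The edges are $xw_i,\ w_ip_i,\ xu_i,\ u_ig_i,\ g_ip_i$; symmetrically $yw'_i,\ w'_ip'_i,\ yu'_i,\ u'_ig'_i,\ g'_ip'_i$; the edges $p_ip'_i$; and, for each $j$, the edges of three paths of length $3$ joining $p_j$ to $p_{j+1}$, $p'_j$ to $p'_{j+1}$, and $p_j$ to $p'_{j+1}$, respectively, the two interior vertices of each path being one of the red pairs. **The graph $G$.** Take two disjoint edges $ab$ and $cd$, and for each of the four pairs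 $(x,y)\in\{a,b\}\times\{c,d\}$ add seven copies of $F_{x,y}$; distinct copies share no vertices other than terminals. **The green parts.** The green part of $F_{x,y}$ consists of the vertices $u_i,g_i,u'_i,g'_i$. The green part of $G$ consists of all non-terminal vertices of two of the seven copies for each pair $(x,y)$, together with the green parts of the remaining copies. Let $F^-_{x,y}$ and $G^-$ be the graphs obtained from $F_{x,y}$ and $G$ by deleting the green vertices. Then: 1. In every $(0,3)$-coloring of $F_{x,y}$, some neighbor of $x$ or of $y$ is not colored $0$. 2. $G$ is a $(C_3,C_4,C_6)$-free planar graph, and $G$ is not $(0,3)$-colorable. 3. In every $(0,2)$-coloring of $F^-_{x,y}$, some neighbor of $x$ or of $y$ is not colored $0$. 4. $G^-$ is a planar graph of girth $7$ on $684$ vertices, and $G^-$ is not $(0,2)$-colorable. -/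

import Mathlib

/-- The set `A` is the first class of a `(k₁, k₂)`-coloring of `G`: the subgraph induced by `A` has
maximum degree at most `k₁`, the subgraph induced by the complement of `A` has maximum degree at
most `k₂`. For `k₁ = 0` the vertices of `A` are those "colored `0`". -/
def IsDefectiveColoring {V : Type*} (G : SimpleGraph V) (k₁ k₂ : ℕ) (A : Set V) : Prop :=
  (∀ v ∈ A, (G.neighborSet v ∩ A).encard ≤ k₁) ∧
    (∀ v ∈ Aᶜ, (G.neighborSet v ∩ Aᶜ).encard ≤ k₂)

/-- `G` is `(k₁, k₂)`-colorable. -/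
def IsDefectiveColorable {V : Type*} (G : SimpleGraph V) (k₁ k₂ : ℕ) : Prop :=
  ∃ A : Set V, IsDefectiveColoring G k₁ k₂ A

/-- `A` is a simple arc in the plane with end points `p` and `q`. -/
def IsPlaneArc (A : Set (ℝ × ℝ)) (p q : ℝ × ℝ) : Prop :=
  ∃ γ : unitInterval → ℝ × ℝ,
    Continuous γ ∧ Function.Injective γ ∧ γ 0 = p ∧ γ 1 = q ∧ Set.range γ = A

/-- `G` can be drawn in the plane: the vertices are distinct points, every edge is a simple arc
that joins its two ends and meets no other vertex, and two distinct edges meet at most in the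
images of their common ends. -/
def IsPlanarGraph {V : Type*} (G : SimpleGraph V) : Prop :=
  ∃ (pos : V → ℝ × ℝ) (arc : Sym2 V → Set (ℝ × ℝ)),
    Function.Injective pos ∧
    (∀ u v, G.Adj u v → IsPlaneArc (arc s(u, v)) (pos u) (pos v)) ∧
    (∀ e ∈ G.edgeSet, ∀ w, pos w ∈ arc e → w ∈ e) ∧
    (∀ e ∈ G.edgeSet, ∀ f ∈ G.edgeSet, e ≠ f →
      arc e ∩ arc f ⊆ pos '' {w | w ∈ e ∧ w ∈ f})

/-- The class of `(C₃, C₄, C₆)`-free planar graphs. -/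
def InClassC {V : Type*} (G : SimpleGraph V) : Prop :=
  IsPlanarGraph G ∧ (SimpleGraph.cycleGraph 3).Free G ∧ (SimpleGraph.cycleGraph 4).Free G ∧
    (SimpleGraph.cycleGraph 6).Free G

/-- The vertices of the forcing gadget other than its terminals. A first argument `s : Bool` says
on which side the vertex lies: `false` for the side of `x`, `true` for the side of `y`. -/
inductive GadgetInner : Type
  /-- white neighbours of the terminals -/
  | white (s : Bool) (i : Fin 4)
  /-- the eight big vertices -/
  | big (s : Bool) (i : Fin 4)
  /-- the red vertices: `red j m false` and `red j m true` form the pair number `m` of three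
  pairs between the levels `j` and `j + 1` -/
  | red (j : Fin 3) (m : Fin 3) (e : Bool)
  /-- green neighbours of the terminals (also white in the sense of the coloring argument) -/
  | greenWhite (s : Bool) (i : Fin 4)
  /-- green neighbours of the big vertices -/
  | greenNbr (s : Bool) (i : Fin 4)
  deriving DecidableEq, Fintype

/-- The vertices of the forcing gadget `F_{x,y}`. -/
inductive GadgetVertex : Type
  /-- `terminal false` is `x` and `terminal true` is `y` -/
  | terminal (s : Bool)
  | inner (v : GadgetInner)
  deriving DecidableEq, Fintype

/-- The big vertex `(side, level)` to which the red vertex `red j m e` is attached. The pair `0`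
joins the big vertices of levels `j` and `j + 1` on the side of `x`, the pair `1` those on the side
of `y`, and the pair `2` joins level `j` on the side of `x` to level `j + 1` on the side of `y`. -/
def redEnd (j : Fin 3) (m : Fin 3) (e : Bool) : Bool × Fin 4 :=
  (if m = 0 then false else if m = 1 then true else e, if e then j.succ else j.castSucc)

/-- The edges of the gadget, each in at least one direction. -/
def gadgetRel : GadgetVertex → GadgetVertex → Prop
  | .terminal s, .inner (.white t _) => s = t
  | .inner (.white s i), .inner (.big t j) => s = t ∧ i = j
  | .inner (.big s i), .inner (.big t j) => s ≠ t ∧ i = j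
  | .inner (.big s i), .inner (.red j m e) => (s, i) = redEnd j m e
  | .inner (.red j m e), .inner (.red j' m' e') => j = j' ∧ m = m' ∧ e ≠ e'
  | .terminal s, .inner (.greenWhite t _) => s = t
  | .inner (.greenWhite s i), .inner (.greenNbr t j) => s = t ∧ i = j
  | .inner (.greenNbr s i), .inner (.big t j) => s = t ∧ i = j
  | _, _ => False

/-- The forcing gadget `F_{x,y}`. -/
def forcingGadget : SimpleGraph GadgetVertex := SimpleGraph.fromRel gadgetRel

/-- The vertices of the green part of the gadget. -/
def GadgetVertex.IsGreen : GadgetVertex → Prop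
  | .inner (.greenWhite _ _) => True
  | .inner (.greenNbr _ _) => True
  | _ => False

/-- The vertices of the full construction: the four ends `hub e p` of the two drawn edges (`e` is
the edge, `p` the end), and for every end `p` of the first edge and every end `q` of the second one
the inner vertices of seven copies of the gadget. -/
inductive FullVertex : Type
  | hub (e p : Bool)
  | copy (p q : Bool) (c : Fin 7) (v : GadgetInner)
  deriving DecidableEq, Fintype

/-- The position in the full construction of the vertices of the copy number `c` that links the
end `p` of the first edge to the end `q` of the second edge. -/
def placeCopy (p q : Bool) (c : Fin 7) : GadgetVertex → FullVertex
  | .terminal false => .hub false p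
  | .terminal true => .hub true q
  | .inner v => .copy p q c v

/-- The full construction: two disjoint edges, and seven copies of the gadget between each end of
the first edge and each end of the second edge. -/
def fullGraph : SimpleGraph FullVertex :=
  SimpleGraph.fromRel fun u v =>
    (∃ e, u = .hub e false ∧ v = .hub e true) ∨
    (∃ p q c a b, forcingGadget.Adj a b ∧ u = placeCopy p q c a ∧ v = placeCopy p q c b)

/-- The green part of the full construction: two of the seven copies in each bundle, and the green
part of each of the other copies. -/
def FullVertex.IsGreen : FullVertex → Prop
  | .hub _ _ => False
  | .copy _ _ c v => 5 ≤ c ∨ (GadgetVertex.inner v).IsGreen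

/-- The gadget without its green part. -/
def reducedGadget : SimpleGraph {v : GadgetVertex // ¬ v.IsGreen} :=
  forcingGadget.induce {v : GadgetVertex | ¬ v.IsGreen}

/-- The full construction without its green part. -/
def reducedGraph : SimpleGraph {v : FullVertex // ¬ v.IsGreen} :=
  fullGraph.induce {v : FullVertex | ¬ v.IsGreen}

/-! Colorings. Suppose all neighbors of `x` and `y` are colored 0. Then the eight big vertices,
being adjacent to white ones, are not. Each of the nine red pairs has a vertex not colored 0, and
each red vertex is attached to one big vertex, so by pigeonhole some big vertex has two such red
neighbors (`exists_two_red_notMem`). Together with the opposite big vertex and the green neighbor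
these are four neighbors in the second class, and still three without the green one: one more than
allowed in either case. In the full construction each of the two hub edges has an end that is not
colored 0. Every copy between these two ends supplies one of them with a further neighbor not
colored 0; seven copies exceed 2 * 3, and the five copies left after the reduction exceed 2 * 2.

Short cycles. A copy is attached to the rest only at its terminals, which are at distance 5. A cycle
that leaves a copy passes through both terminals and hence has length at least 10, so a cycle of
length at most 6 stays in one gadget (`exists_placeCopy_of_isCycle`). There an exhaustive search of
paths, evaluated by the kernel, finds only 5-cycles with green vertices.

Planarity. The gadget is drawn with straight segments between integral points in a strip whose
vertical sides stand for the terminals; `oneSide_or` checks this drawing by signs of determinants.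
The maps `drawCopy` contract the sides to points and place the 28 strips side by side without
overlap (`drawCopy_eq`). -/

/-! ### Defective colorings -/

/-- The two ends of an edge are not both in the independent class of a `(0, k)`-coloring. -/
theorem IsDefectiveColoring.not_mem_of_adj {V : Type*} {G : SimpleGraph V} {k : ℕ} {A : Set V}
    (hA : IsDefectiveColoring G 0 k A) {u v : V} (h : G.Adj u v) (hu : u ∈ A) : v ∉ A := by
  intro hv
  have h0 := hA.1 u hu
  simp only [Nat.cast_zero, nonpos_iff_eq_zero, Set.encard_eq_zero] at h0
  exact (Set.mem_empty_iff_false v).1 (h0 ▸ ⟨h, hv⟩)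

/-- A vertex of the second class has at most `k` neighbors in that class. -/
theorem IsDefectiveColoring.card_le {V : Type*} {G : SimpleGraph V} {k₁ k : ℕ} {A : Set V}
    (hA : IsDefectiveColoring G k₁ k A) {v : V} (hv : v ∉ A) (s : Finset V)
    (hs : ∀ u ∈ s, G.Adj v u ∧ u ∉ A) : s.card ≤ k := by
  have h1 : (s : Set V).encard ≤ (G.neighborSet v ∩ Aᶜ).encard := Set.encard_le_encard hs
  have h2 := h1.trans (hA.2 v hv)
  rw [Set.encard_coe_eq_coe_finsetCard] at h2
  exact_mod_cast h2

/-- Defective colorings pull back along injective homomorphisms. -/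
theorem IsDefectiveColoring.comap {V W : Type*} {G : SimpleGraph V} {H : SimpleGraph W}
    {k₁ k₂ : ℕ} {A : Set W} (hA : IsDefectiveColoring H k₁ k₂ A) (f : G →g H)
    (hf : Function.Injective f) : IsDefectiveColoring G k₁ k₂ (f ⁻¹' A) := by
  constructor
  · intro v hv
    refine le_trans ?_ (hA.1 (f v) hv)
    rw [← hf.encard_image]
    apply Set.encard_le_encard
    rintro _ ⟨u, ⟨hu, hu'⟩, rfl⟩
    exact ⟨f.map_adj hu, hu'⟩
  · intro v hv
    refine le_trans ?_ (hA.2 (f v) hv)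
    rw [← hf.encard_image]
    apply Set.encard_le_encard
    rintro _ ⟨u, ⟨hu, hu'⟩, rfl⟩
    exact ⟨f.map_adj hu, hu'⟩

/-- Two vertices of the second class have together at most `2 * k` neighbors
in that class. -/
theorem IsDefectiveColoring.card_le_two_mul {V : Type*} {G : SimpleGraph V} {k₁ k : ℕ} {A : Set V}
    (hA : IsDefectiveColoring G k₁ k A) (x : Bool → V) (hx : ∀ s, x s ∉ A)
    {ι : Type*} [Fintype ι] (u : ι → V) (hu : Function.Injective u)
    (h : ∀ i, u i ∉ A ∧ ∃ s, G.Adj (x s) (u i)) : Fintype.card ι ≤ 2 * k := by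
  classical
  choose h1 s hs using h
  by_contra! hlt
  obtain ⟨b, -, hb⟩ := Finset.exists_lt_card_fiber_of_mul_lt_card_of_maps_to
    (s := Finset.univ) (t := Finset.univ) (f := s) (n := k) (by simp) (by simpa using hlt)
  have := hA.card_le (hx b) ((Finset.univ.filter (s · = b)).map ⟨u, hu⟩) (by
    simp only [Finset.mem_map, Finset.mem_filter, Finset.mem_univ, true_and]
    rintro _ ⟨i, rfl, rfl⟩
    exact ⟨hs i, h1 i⟩)
  rw [Finset.card_map] at this
  omega

/-! ### Colorings of the gadget -/

theorem forcingGadget_adj {u v : GadgetVertex} :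
    forcingGadget.Adj u v ↔ u ≠ v ∧ (gadgetRel u v ∨ gadgetRel v u) :=
  SimpleGraph.fromRel_adj ..

/-- If of each red pair one vertex is picked, then two of these vertices are attached to the same
big vertex. -/
theorem exists_redEnd_eq (e : Fin 3 → Fin 3 → Bool) :
    ∃ j m j' m', (j, m) ≠ (j', m') ∧ redEnd j m (e j m) = redEnd j' m' (e j' m') := by
  -- Nine pairs against eight big vertices.
  obtain ⟨a, b, hab, h⟩ := Fintype.exists_ne_map_eq_of_card_lt
    (fun a : Fin 3 × Fin 3 => redEnd a.1 a.2 (e a.1 a.2)) (by simp)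
  exact ⟨a.1, a.2, b.1, b.2, hab, h⟩

/-- If `A` contains not both vertices of any red pair, then some big vertex has two red neighbors
outside of `A`. -/
theorem exists_two_red_notMem (A : Set GadgetVertex)
    (hA : ∀ j m, .inner (.red j m false) ∈ A → .inner (.red j m true) ∉ A) :
    ∃ s i, ∃ r r' : Fin 3 × Fin 3 × Bool, r ≠ r' ∧
      (forcingGadget.Adj (.inner (.big s i)) (.inner (.red r.1 r.2.1 r.2.2)) ∧
        .inner (.red r.1 r.2.1 r.2.2) ∉ A) ∧
      (forcingGadget.Adj (.inner (.big s i)) (.inner (.red r'.1 r'.2.1 r'.2.2)) ∧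
        .inner (.red r'.1 r'.2.1 r'.2.2) ∉ A) := by
  have hex : ∀ j m, ∃ e, GadgetVertex.inner (.red j m e) ∉ A := by
    intro j m
    by_cases h : GadgetVertex.inner (.red j m false) ∈ A
    · exact ⟨true, hA j m h⟩
    · exact ⟨false, h⟩
  choose e he using hex
  obtain ⟨j, m, j', m', hne, heq⟩ := exists_redEnd_eq e
  refine ⟨(redEnd j m (e j m)).1, (redEnd j m (e j m)).2, (j, m, e j m), (j', m', e j' m'), ?_,
    ⟨?_, he j m⟩, ⟨?_, he j' m'⟩⟩
  · intro h
    simp only [Prod.mk.injEq] at h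
    exact hne (Prod.ext h.1 h.2.1)
  · simp [forcingGadget_adj, gadgetRel]
  · simp [forcingGadget_adj, gadgetRel, heq]

theorem forcingGadget_coloring (A : Set GadgetVertex)
    (hA : IsDefectiveColoring forcingGadget 0 3 A) :
    ∃ (s : Bool) (v : GadgetVertex), forcingGadget.Adj (.terminal s) v ∧ v ∉ A := by
  by_contra! hcon
  have hwhite : ∀ s i, GadgetVertex.inner (.white s i) ∈ A := fun s i =>
    hcon s _ (by simp [forcingGadget_adj, gadgetRel])
  have hgw : ∀ s i, GadgetVertex.inner (.greenWhite s i) ∈ A := fun s i =>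
    hcon s _ (by simp [forcingGadget_adj, gadgetRel])
  have hbig : ∀ s i, GadgetVertex.inner (.big s i) ∉ A := fun s i =>
    hA.not_mem_of_adj (by simp [forcingGadget_adj, gadgetRel]) (hwhite s i)
  have hgn : ∀ s i, GadgetVertex.inner (.greenNbr s i) ∉ A := fun s i =>
    hA.not_mem_of_adj (by simp [forcingGadget_adj, gadgetRel]) (hgw s i)
  obtain ⟨s, i, r, r', hne, h, h'⟩ := exists_two_red_notMem A fun j m =>
    hA.not_mem_of_adj (by simp [forcingGadget_adj, gadgetRel])
  -- Four distinct neighbors outside of `A`: the opposite big vertex, the green neighbor, two red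
  -- vertices.
  have := hA.card_le (hbig s i) {.inner (.big (!s) i), .inner (.greenNbr s i),
    .inner (.red r.1 r.2.1 r.2.2), .inner (.red r'.1 r'.2.1 r'.2.2)} (by
      simp only [Finset.mem_insert, Finset.mem_singleton]
      rintro u (rfl | rfl | rfl | rfl)
      · exact ⟨by simp [forcingGadget_adj, gadgetRel], hbig _ _⟩
      · exact ⟨by simp [forcingGadget_adj, gadgetRel], hgn _ _⟩
      · exact h
      · exact h')
  rw [Finset.card_insert_of_notMem (by simp), Finset.card_insert_of_notMem (by simp),
    Finset.card_pair] at this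
  · omega
  · simpa [Prod.ext_iff] using hne

theorem reducedGadget_coloring (A : Set {v : GadgetVertex // ¬ v.IsGreen})
    (hA : IsDefectiveColoring reducedGadget 0 2 A) :
    ∃ (s : Bool) (v : {v : GadgetVertex // ¬ v.IsGreen}),
      forcingGadget.Adj (.terminal s) v ∧ v ∉ A := by
  by_contra! hcon
  have hwhite : ∀ s i, (⟨.inner (.white s i), id⟩ : {v : GadgetVertex // ¬ v.IsGreen}) ∈ A :=
    fun s i => hcon s _ (by simp [forcingGadget_adj, gadgetRel])
  have hbig : ∀ s i, (⟨.inner (.big s i), id⟩ : {v : GadgetVertex // ¬ v.IsGreen}) ∉ A :=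
    fun s i => hA.not_mem_of_adj (by simp [reducedGadget, forcingGadget_adj, gadgetRel])
      (hwhite s i)
  -- No red vertex is green, so the pigeonhole argument of the whole gadget applies to the image of
  -- `A`.
  obtain ⟨s, i, r, r', hne, h, h'⟩ := exists_two_red_notMem (Subtype.val '' A) (by
    rintro j m ⟨u, hu, hu'⟩ ⟨v, hv, hv'⟩
    refine hA.not_mem_of_adj (u := u) (v := v) ?_ hu hv
    simp [reducedGadget, forcingGadget_adj, gadgetRel, hu', hv'])
  have := hA.card_le (hbig s i) {⟨.inner (.big (!s) i), id⟩,
    ⟨.inner (.red r.1 r.2.1 r.2.2), id⟩, ⟨.inner (.red r'.1 r'.2.1 r'.2.2), id⟩} (by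
      simp only [Finset.mem_insert, Finset.mem_singleton]
      rintro u (rfl | rfl | rfl)
      · exact ⟨by simp [reducedGadget, forcingGadget_adj, gadgetRel], hbig _ _⟩
      · exact ⟨h.1, fun hr => h.2 ⟨_, hr, rfl⟩⟩
      · exact ⟨h'.1, fun hr => h'.2 ⟨_, hr, rfl⟩⟩)
  rw [Finset.card_insert_of_notMem (by simp [Subtype.ext_iff]), Finset.card_pair] at this
  · omega
  · simpa [Subtype.ext_iff, Prod.ext_iff] using hne

/-! ### Colorings of the full construction -/

theorem placeCopy_injective (p q : Bool) (c : Fin 7) : Function.Injective (placeCopy p q c) := by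
  rintro ((_ | _) | _) ((_ | _) | _) h <;> simp_all [placeCopy]

theorem fullGraph_adj_placeCopy (p q : Bool) (c : Fin 7) {a b : GadgetVertex}
    (h : forcingGadget.Adj a b) : fullGraph.Adj (placeCopy p q c a) (placeCopy p q c b) :=
  (SimpleGraph.fromRel_adj ..).2 ⟨(placeCopy_injective p q c).ne h.ne,
    .inl (.inr ⟨p, q, c, a, b, h, rfl, rfl⟩)⟩

theorem fullGraph_adj_hub (e : Bool) : fullGraph.Adj (.hub e false) (.hub e true) :=
  (SimpleGraph.fromRel_adj ..).2 ⟨by simp, .inl (.inl ⟨e, rfl, rfl⟩)⟩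

/-- The neighbors of the terminals of the gadget are inner vertices. -/
theorem exists_inner_of_adj_terminal {s : Bool} {v : GadgetVertex}
    (h : forcingGadget.Adj (.terminal s) v) : ∃ u, v = .inner u := by
  rcases v with t | u
  · simp [forcingGadget_adj, gadgetRel] at h
  · exact ⟨u, rfl⟩

theorem placeCopy_terminal (p q s : Bool) (c : Fin 7) :
    placeCopy p q c (.terminal s) = .hub s (if s then q else p) := by
  cases s <;> rfl

/-- Only the bundle between two hubs outside of `A` matters: its seven copies give seven distinct
vertices outside of `A`, each adjacent to one of these hubs, which can absorb only 2 * 3. -/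
theorem not_isDefectiveColorable_fullGraph : ¬ IsDefectiveColorable fullGraph 0 3 := by
  rintro ⟨A, hA⟩
  have hub : ∀ e, ∃ p, FullVertex.hub e p ∉ A := by
    intro e
    by_cases h : FullVertex.hub e false ∈ A
    · exact ⟨true, hA.not_mem_of_adj (fullGraph_adj_hub e) h⟩
    · exact ⟨false, h⟩
  obtain ⟨p, hp⟩ := hub false
  obtain ⟨q, hq⟩ := hub true
  have key : ∀ c : Fin 7, ∃ v, FullVertex.copy p q c v ∉ A ∧
      ∃ s, fullGraph.Adj (.hub s (if s then q else p)) (.copy p q c v) := by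
    intro c
    obtain ⟨s, v, hv, hvA⟩ := forcingGadget_coloring _
      (hA.comap ⟨placeCopy p q c, fullGraph_adj_placeCopy p q c⟩ (placeCopy_injective p q c))
    obtain ⟨u, rfl⟩ := exists_inner_of_adj_terminal hv
    exact ⟨u, hvA, s, by simpa [placeCopy] using placeCopy_terminal p q s c ▸
      fullGraph_adj_placeCopy p q c hv⟩
  choose v hv using key
  have := hA.card_le_two_mul (fun s => .hub s (if s then q else p))
    (by rintro (_ | _) <;> simpa) (fun c => .copy p q c (v c))
    (fun c d h => by simpa using (FullVertex.copy.inj h).2.2.1) hv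
  simp at this

theorem not_isGreen_placeCopy (p q : Bool) {c : Fin 7} (hc : ¬ 5 ≤ c) {a : GadgetVertex}
    (ha : ¬ a.IsGreen) : ¬ (placeCopy p q c a).IsGreen := by
  rcases a with (_ | _) | v
  · exact id
  · exact id
  · exact not_or.2 ⟨hc, ha⟩

/-- The copies of the reduced gadget in the reduced construction. -/
def reducedPlaceCopy (p q : Bool) {c : Fin 7} (hc : ¬ 5 ≤ c) : reducedGadget →g reducedGraph where
  toFun a := ⟨placeCopy p q c a.1, not_isGreen_placeCopy p q hc a.2⟩
  map_rel' := fullGraph_adj_placeCopy p q c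

theorem not_isDefectiveColorable_reducedGraph : ¬ IsDefectiveColorable reducedGraph 0 2 := by
  rintro ⟨A, hA⟩
  have hub : ∀ e, ∃ p, (⟨.hub e p, id⟩ : {v : FullVertex // ¬ v.IsGreen}) ∉ A := by
    intro e
    by_cases h : (⟨.hub e false, id⟩ : {v : FullVertex // ¬ v.IsGreen}) ∈ A
    · exact ⟨true, hA.not_mem_of_adj (u := ⟨.hub e false, id⟩) (fullGraph_adj_hub e) h⟩
    · exact ⟨false, h⟩
  obtain ⟨p, hp⟩ := hub false
  obtain ⟨q, hq⟩ := hub true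
  -- The copies 0 to 4 survive the reduction, and 5 > 2 * 2.
  have hlt : ∀ c : Fin 5, ¬ (5 : Fin 7) ≤ c.castLE (by omega) := by decide
  have key : ∀ c : Fin 5, ∃ v, ∃ hv : ¬ (FullVertex.copy p q (c.castLE (by omega)) v).IsGreen,
      (⟨_, hv⟩ : {v : FullVertex // ¬ v.IsGreen}) ∉ A ∧
      ∃ s, fullGraph.Adj (.hub s (if s then q else p)) (.copy p q (c.castLE (by omega)) v) := by
    intro c
    obtain ⟨s, ⟨v, hg⟩, hv, hvA⟩ := reducedGadget_coloring _
      (hA.comap (reducedPlaceCopy p q (hlt c))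
        (fun a b h => Subtype.ext (placeCopy_injective _ _ _ (congrArg Subtype.val h))))
    obtain ⟨u, rfl⟩ := exists_inner_of_adj_terminal hv
    exact ⟨u, not_isGreen_placeCopy p q (hlt c) hg, hvA, s, by
      simpa [placeCopy] using placeCopy_terminal p q s (c.castLE (by omega)) ▸
        fullGraph_adj_placeCopy p q (c.castLE (by omega)) hv⟩
  choose v hg hv using key
  have := hA.card_le_two_mul (fun s => ⟨.hub s (if s then q else p), id⟩)
    (by rintro (_ | _) <;> simpa) (fun c => ⟨_, hg c⟩)
    (fun c d h => by
      have := (FullVertex.copy.inj (congrArg Subtype.val h)).2.2.1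
      simpa using this) hv
  simp at this

instance : DecidablePred FullVertex.IsGreen
  | .hub _ _ => isFalse id
  | .copy _ _ _ (.white _ _) => inferInstanceAs (Decidable (_ ∨ False))
  | .copy _ _ _ (.big _ _) => inferInstanceAs (Decidable (_ ∨ False))
  | .copy _ _ _ (.red _ _ _) => inferInstanceAs (Decidable (_ ∨ False))
  | .copy _ _ _ (.greenWhite _ _) => isTrue (.inr trivial)
  | .copy _ _ _ (.greenNbr _ _) => isTrue (.inr trivial)

/-- Four hubs and 4 * 5 copies with 8 white, 8 big and 18 red vertices each: 4 + 20 * 34. -/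
theorem card_reducedGraph : Nat.card {v : FullVertex // ¬ v.IsGreen} = 684 := by
  rw [Nat.card_eq_fintype_card]
  decide +kernel

/-! ### Searching for short cycles -/

/-- Whether all paths of length at most `n` from `u` to `t` that avoid `l` satisfy `Q`, which is
evaluated at the reversed list of vertices of the path followed by `l`. -/
def searchPaths {V : Type*} [DecidableEq V] (nbrs : V → List V) (t : V) (Q : List V → Bool) :
    ℕ → V → List V → Bool
  | 0, u, l => u != t || Q (u :: l)
  | n + 1, u, l => if u = t then Q (u :: l) else
      (nbrs u).all fun v => decide (v ∈ u :: l) || searchPaths nbrs t Q n v (u :: l)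

/-- The next vertex of a path is always fresh, so the search follows the path to its end. The lists
`nbrs` need only contain all neighbors; superfluous entries would merely strengthen the check. -/
theorem searchPaths_sound {V : Type*} [DecidableEq V] {G : SimpleGraph V} {nbrs : V → List V}
    (hn : ∀ u v, G.Adj u v → v ∈ nbrs u) {t : V} {Q : List V → Bool} {u : V} (w : G.Walk u t)
    (hw : w.IsPath) (n : ℕ) (hlen : w.length ≤ n) (l : List V) (hl : ∀ x ∈ w.support, x ∉ l)
    (h : searchPaths nbrs t Q n u l = true) : Q (w.support.reverse ++ l) = true := by
  induction w generalizing n l with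
  | nil =>
    cases n <;> simpa [searchPaths] using h
  | @cons u v t huv w ih =>
    obtain ⟨hw, hu⟩ := SimpleGraph.Walk.cons_isPath_iff huv w |>.1 hw
    have hut : u ≠ t := fun h => hu (h ▸ w.end_mem_support)
    cases n with
    | zero => simp at hlen
    | succ n =>
      rw [searchPaths, if_neg hut, List.all_eq_true] at h
      have hv := h v (hn u v huv)
      have hvl : v ∉ u :: l := by
        rw [List.mem_cons, not_or]
        exact ⟨huv.ne', hl v (by simp)⟩
      rw [decide_eq_false hvl, Bool.false_or] at hv
      have := ih hw n (by simpa using hlen) (u :: l) (fun x hx => by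
        rw [List.mem_cons, not_or]
        exact ⟨fun h => hu (h ▸ hx), hl x (by simp [hx])⟩) hv
      simpa using this

/-- The neighbors of a vertex of the gadget. -/
def gadgetNbrs : GadgetVertex → List GadgetVertex
  | .terminal s => (List.finRange 4).flatMap fun i =>
      [.inner (.white s i), .inner (.greenWhite s i)]
  | .inner (.white s i) => [.terminal s, .inner (.big s i)]
  | .inner (.big s i) => [.inner (.white s i), .inner (.greenNbr s i), .inner (.big (!s) i)] ++
      ((List.finRange 3).flatMap fun j => (List.finRange 3).flatMap fun m =>
        [false, true].flatMap fun e => if (s, i) = redEnd j m e then [.inner (.red j m e)] else [])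
  | .inner (.red j m e) => [.inner (.red j m !e), .inner (.big (redEnd j m e).1 (redEnd j m e).2)]
  | .inner (.greenWhite s i) => [.terminal s, .inner (.greenNbr s i)]
  | .inner (.greenNbr s i) => [.inner (.greenWhite s i), .inner (.big s i)]

theorem mem_gadgetNbrs_of_adj (u v : GadgetVertex) (h : forcingGadget.Adj u v) :
    v ∈ gadgetNbrs u := by
  rw [forcingGadget_adj] at h
  obtain ⟨-, h⟩ := h
  rcases u with s | ⟨s, i⟩ | ⟨s, i⟩ | ⟨j, m, e⟩ | ⟨s, i⟩ | ⟨s, i⟩ <;>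
  rcases v with s' | ⟨s', i'⟩ | ⟨s', i'⟩ | ⟨j', m', e'⟩ | ⟨s', i'⟩ | ⟨s', i'⟩ <;>
  simp only [gadgetRel, or_false, false_or, or_self] at h <;>
  simp only [gadgetNbrs] <;> simp <;>
  first
  | grind
  | (cases s <;> cases s' <;> grind)
  | (cases e <;> cases e' <;> grind)
  | (cases e' <;> grind)

instance : DecidablePred GadgetVertex.IsGreen
  | .terminal _ => isFalse id
  | .inner (.white _ _) => isFalse id
  | .inner (.big _ _) => isFalse id
  | .inner (.red _ _ _) => isFalse id
  | .inner (.greenWhite _ _) => isTrue trivial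
  | .inner (.greenNbr _ _) => isTrue trivial

/-- A cycle is an edge from `a` to `v` closed up by a path from `v` back to `a`, and the number of
vertices of that path is the length of the cycle. The case `l.length < 3` admits the path that runs
back along the edge itself. -/
theorem searchPaths_gadget : ∀ a, ∀ v ∈ gadgetNbrs a, searchPaths gadgetNbrs a
    (fun l => decide (l.length < 3) || (decide (l.length = 5) && l.any (·.IsGreen))) 5 v [] := by
  decide +kernel

/-- The only cycles of length at most `6` in the gadget are `5`-cycles with green vertices. -/
theorem forcingGadget_isCycle {a : GadgetVertex} (w : forcingGadget.Walk a a) (hw : w.IsCycle)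
    (hlen : w.length ≤ 6) : w.length = 5 ∧ ∃ v ∈ w.support, v.IsGreen := by
  have h3 := hw.three_le_length
  cases w with
  | nil => simp at h3
  | @cons _ v _ hav w =>
    rw [SimpleGraph.Walk.cons_isCycle_iff] at hw
    rw [SimpleGraph.Walk.length_cons] at h3 hlen
    have := searchPaths_sound mem_gadgetNbrs_of_adj w hw.1 5 (by omega) [] (by simp)
      (searchPaths_gadget a v (mem_gadgetNbrs_of_adj a v hav))
    simp only [List.append_nil, List.length_reverse, SimpleGraph.Walk.length_support,
      Bool.or_eq_true, decide_eq_true_eq, Bool.and_eq_true, List.any_reverse, List.any_eq_true]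
      at this
    obtain h | ⟨h, v, hv, hg⟩ := this
    · omega
    · exact ⟨by simpa using h, v, by simp [hv], hg⟩

/-! ### Short cycles of the full construction -/

theorem fullGraph_adj_iff {u v : FullVertex} : fullGraph.Adj u v ↔
    (∃ e p, u = .hub e p ∧ v = .hub e !p) ∨
    (∃ p q c a b, forcingGadget.Adj a b ∧ u = placeCopy p q c a ∧ v = placeCopy p q c b) := by
  constructor
  · intro h
    obtain ⟨-, h⟩ := (SimpleGraph.fromRel_adj ..).1 h
    rcases h with (⟨e, rfl, rfl⟩ | h) | (⟨e, rfl, rfl⟩ | ⟨p, q, c, a, b, hab, rfl, rfl⟩)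
    · exact .inl ⟨e, false, rfl, rfl⟩
    · exact .inr h
    · exact .inl ⟨e, true, rfl, rfl⟩
    · exact .inr ⟨p, q, c, b, a, hab.symm, rfl, rfl⟩
  · rintro (⟨e, (_ | _), rfl, rfl⟩ | ⟨p, q, c, a, b, h, rfl, rfl⟩)
    · exact fullGraph_adj_hub e
    · exact (fullGraph_adj_hub e).symm
    · exact fullGraph_adj_placeCopy p q c h

/-- The neighbors of an inner vertex of a copy belong to the copy. -/
theorem fullGraph_adj_copy {p q : Bool} {c : Fin 7} {v : GadgetInner} {u : FullVertex}
    (h : fullGraph.Adj (.copy p q c v) u) :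
    ∃ b, forcingGadget.Adj (.inner v) b ∧ u = placeCopy p q c b := by
  rw [fullGraph_adj_iff] at h
  obtain ⟨_, _, h, -⟩ | ⟨p', q', c', a, b, hab, h, rfl⟩ := h
  · cases h
  · rcases a with (_ | _) | a
    · cases h
    · cases h
    · cases h
      exact ⟨b, hab, rfl⟩

theorem fullGraph_adj_placeCopy_iff (p q : Bool) (c : Fin 7) {a b : GadgetVertex} :
    fullGraph.Adj (placeCopy p q c a) (placeCopy p q c b) ↔ forcingGadget.Adj a b := by
  refine ⟨fun h => ?_, fullGraph_adj_placeCopy p q c⟩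
  rcases a with s | a
  · rcases b with t | b
    · rw [placeCopy_terminal, placeCopy_terminal, fullGraph_adj_iff] at h
      obtain ⟨e, p', h1, h2⟩ | ⟨p', q', c', a, b, hab, h1, h2⟩ := h
      · cases s <;> cases t <;> cases p' <;> simp_all
      · rcases a with s' | a
        · obtain ⟨b, rfl⟩ := exists_inner_of_adj_terminal hab
          cases h2
        · cases h1
    · obtain ⟨x, hx, hx'⟩ := fullGraph_adj_copy h.symm
      exact (placeCopy_injective p q c hx' ▸ hx).symm
  · obtain ⟨x, hx, hx'⟩ := fullGraph_adj_copy h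
    exact placeCopy_injective p q c hx' ▸ hx

/-- A copy of the gadget as an induced subgraph of the full construction. -/
def placeCopyEmbedding (p q : Bool) (c : Fin 7) : forcingGadget ↪g fullGraph where
  toFun := placeCopy p q c
  inj' := placeCopy_injective p q c
  map_rel_iff' := fullGraph_adj_placeCopy_iff p q c

/-- The distance from the terminal `x` of some vertices of the gadget, extended to a function that
changes by at most `1` along the edges. -/
def gadgetLevel : GadgetVertex → ℤ
  | .terminal s => if s then 5 else 0
  | .inner (.white s _) => if s then 4 else 1
  | .inner (.big s _) => if s then 3 else 2
  | .inner (.red _ m e) => if m = 0 then 2 else if m = 1 then 3 else if e then 3 else 2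
  | .inner (.greenWhite s _) => if s then 4 else 1
  | .inner (.greenNbr s _) => if s then 3 else 2

theorem gadgetLevel_le_of_adj {a b : GadgetVertex} (h : forcingGadget.Adj a b) :
    gadgetLevel b ≤ gadgetLevel a + 1 := by
  have key : ∀ a, ∀ b ∈ gadgetNbrs a, gadgetLevel b ≤ gadgetLevel a + 1 := by decide +kernel
  exact key a b (mem_gadgetNbrs_of_adj a b h)

/-- The function `gadgetLevel` on all copies of the gadget. -/
def fullLevel : FullVertex → ℤ
  | .hub e _ => gadgetLevel (.terminal e)
  | .copy _ _ _ v => gadgetLevel (.inner v)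

theorem fullLevel_placeCopy (p q : Bool) (c : Fin 7) (a : GadgetVertex) :
    fullLevel (placeCopy p q c a) = gadgetLevel a := by
  rcases a with (_ | _) | _ <;> rfl

theorem fullLevel_le_of_adj {u v : FullVertex} (h : fullGraph.Adj u v) :
    fullLevel v ≤ fullLevel u + 1 := by
  obtain ⟨e, p, rfl, rfl⟩ | ⟨p, q, c, a, b, hab, rfl, rfl⟩ := fullGraph_adj_iff.1 h
  · simp [fullLevel]
  · simpa [fullLevel_placeCopy] using gadgetLevel_le_of_adj hab

theorem fullLevel_le_of_walk {u v : FullVertex} (w : fullGraph.Walk u v) :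
    fullLevel v ≤ fullLevel u + w.length := by
  induction w with
  | nil => simp
  | cons h w ih =>
    have := fullLevel_le_of_adj h
    push_cast [SimpleGraph.Walk.length_cons]
    omega

/-- A closed walk through ends of both hub edges has length at least `10`. -/
theorem ten_le_length_of_hub_mem {a : FullVertex} (w : fullGraph.Walk a a) {p q : Bool}
    (hp : .hub false p ∈ w.support) (hq : .hub true q ∈ w.support) : 10 ≤ w.length := by
  -- Based at a hub of level 0, the walk climbs to level 5 and returns, which takes at least 5 steps
  -- each way.
  have hq' := (SimpleGraph.Walk.mem_support_rotate_iff w _ hp).2 hq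
  have h1 := fullLevel_le_of_walk ((w.rotate _ hp).takeUntil _ hq')
  have h2 := fullLevel_le_of_walk ((w.rotate _ hp).dropUntil _ hq').reverse
  have h3 := congrArg SimpleGraph.Walk.length ((w.rotate _ hp).take_spec hq')
  rw [SimpleGraph.Walk.length_append, SimpleGraph.Walk.length_rotate] at h3
  simp only [fullLevel, gadgetLevel, SimpleGraph.Walk.length_reverse] at h1 h2
  simp at h1 h2
  omega

/-- Every cycle of the full construction has a vertex that is not a hub. -/
theorem exists_copy_mem_of_isCycle {a : FullVertex} (w : fullGraph.Walk a a) (hw : w.IsCycle) :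
    ∃ p q c v, .copy p q c v ∈ w.support := by
  by_contra! hcon
  have hub : ∀ u ∈ w.support, ∃ e p, u = .hub e p := by
    rintro (⟨e, p⟩ | ⟨p, q, c, v⟩) hu
    · exact ⟨e, p, rfl⟩
    · exact (hcon _ _ _ _ hu).elim
  obtain ⟨e, p, rfl⟩ := hub a w.start_mem_support
  have huniq : ∀ u ∈ w.support, fullGraph.Adj (.hub e p) u → u = .hub e !p := by
    intro u hu h
    obtain ⟨e', p', rfl⟩ := hub u hu
    obtain ⟨_, _, h1, h2⟩ | ⟨p', q', c', a, b, hab, h1, h2⟩ := fullGraph_adj_iff.1 h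
    · cases h1
      exact h2
    · rcases a with s' | a
      · obtain ⟨b, rfl⟩ := exists_inner_of_adj_terminal hab
        cases h2
      · cases h1
  -- A hub has just one neighbor among the hubs, so the cycle would leave and reenter its base point
  -- by the same vertex.
  apply hw.snd_ne_penultimate
  rw [huniq w.snd (w.getVert_mem_support _) (w.adj_snd hw.not_nil),
    huniq w.penultimate (w.getVert_mem_support _) (w.adj_penultimate hw.not_nil).symm]

/-- A walk that leaves a copy of the gadget does so through a hub. -/
theorem exists_hub_mem_of_walk {p q : Bool} {c : Fin 7} {v : GadgetInner} {z : FullVertex}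
    (w : fullGraph.Walk (.copy p q c v) z) (hz : ∀ u, z ≠ .copy p q c u) :
    ∃ s, placeCopy p q c (.terminal s) ∈ w.support := by
  obtain ⟨d, hd, ⟨u, hu⟩, h2⟩ := w.exists_boundary_dart
    {x | ∃ u, x = .copy p q c u} ⟨v, rfl⟩ (fun ⟨u, h⟩ => hz u h)
  obtain ⟨b, -, hb⟩ := fullGraph_adj_copy (hu ▸ d.adj)
  rcases b with s | b
  · exact ⟨s, hb ▸ w.dart_snd_mem_support_of_mem_darts hd⟩
  · exact (h2 ⟨b, hb⟩).elim

/-- A cycle of length at most `6` lies in one copy of the gadget. -/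
theorem exists_placeCopy_of_isCycle {a : FullVertex} (w : fullGraph.Walk a a) (hw : w.IsCycle)
    (hlen : w.length ≤ 6) : ∃ p q c, ∀ u ∈ w.support, u ∈ Set.range (placeCopy p q c) := by
  obtain ⟨p, q, c, v, hv⟩ := exists_copy_mem_of_isCycle w hw
  refine ⟨p, q, c, fun z hz => ?_⟩
  by_contra hzr
  have hz' := (SimpleGraph.Walk.mem_support_rotate_iff w _ hv).2 hz
  have hcyc := hw.rotate hv
  have hspec := (w.rotate _ hv).take_spec hz'
  have hne : ∀ u, z ≠ .copy p q c u := fun u h => hzr ⟨.inner u, h.symm⟩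
  obtain ⟨s, hs⟩ := exists_hub_mem_of_walk ((w.rotate _ hv).takeUntil _ hz') hne
  obtain ⟨t, ht⟩ := exists_hub_mem_of_walk ((w.rotate _ hv).dropUntil _ hz').reverse hne
  rw [SimpleGraph.Walk.support_reverse, List.mem_reverse] at ht
  have hs' : placeCopy p q c (.terminal s) ∈ w.support :=
    (SimpleGraph.Walk.mem_support_rotate_iff w _ hv).1
      (SimpleGraph.Walk.support_takeUntil_subset_support _ _ hs)
  have ht' : placeCopy p q c (.terminal t) ∈ w.support :=
    (SimpleGraph.Walk.mem_support_rotate_iff w _ hv).1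
      (SimpleGraph.Walk.support_dropUntil_subset_support _ _ ht)
  -- Both arcs of the cycle between the inner vertex and `z` pass through a terminal of the copy. If
  -- it is the same one, the cycle repeats a vertex; if not, the cycle is too long.
  by_cases hst : s = t
  · subst hst
    have hnd := hcyc.support_nodup
    rw [← hspec, SimpleGraph.Walk.tail_support_append, List.nodup_append'] at hnd
    refine List.disjoint_left.1 hnd.2.2
      (?_ : placeCopy p q c (.terminal s) ∈ _) ?_
    · rw [SimpleGraph.Walk.mem_support_iff] at hs
      exact hs.resolve_left (by cases s <;> simp [placeCopy])
    · rw [SimpleGraph.Walk.mem_support_iff] at ht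
      exact ht.resolve_left fun h => hzr ⟨_, h⟩
  · have : 10 ≤ w.length := by
      cases s <;> cases t
      · exact (hst rfl).elim
      · exact ten_le_length_of_hub_mem w hs' ht'
      · exact ten_le_length_of_hub_mem w ht' hs'
      · exact (hst rfl).elim
    omega

/-- A walk in the range of an embedding is the image of a walk. -/
theorem exists_map_walk_eq {V W : Type*} {G : SimpleGraph V} {H : SimpleGraph W} (f : G ↪g H)
    {u v : W} (w : H.Walk u v) (hw : ∀ x ∈ w.support, x ∈ Set.range f) {a b : V} (ha : f a = u)
    (hb : f b = v) : ∃ w' : G.Walk a b, (w'.map f.toHom).copy ha hb = w := by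
  induction w generalizing a with
  | nil =>
    subst ha
    obtain rfl := f.injective hb
    exact ⟨.nil, rfl⟩
  | @cons u x v h w ih =>
    obtain ⟨y, rfl⟩ := hw x (by simp)
    obtain ⟨w', rfl⟩ := ih (fun z hz => hw z (by simp [hz])) rfl hb
    subst ha hb
    exact ⟨.cons (f.map_rel_iff.1 h) w', rfl⟩

/-- The only cycles of length at most `6` in the full construction are `5`-cycles with green
vertices. -/
theorem fullGraph_isCycle {a : FullVertex} (w : fullGraph.Walk a a) (hw : w.IsCycle)
    (hlen : w.length ≤ 6) : w.length = 5 ∧ ∃ v ∈ w.support, v.IsGreen := by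
  obtain ⟨p, q, c, h⟩ := exists_placeCopy_of_isCycle w hw hlen
  obtain ⟨a, rfl⟩ := h a w.start_mem_support
  obtain ⟨w, rfl⟩ := exists_map_walk_eq (placeCopyEmbedding p q c) w h (a := a) (b := a) rfl rfl
  change (w.map (placeCopyEmbedding p q c).toHom).IsCycle at hw
  change (w.map (placeCopyEmbedding p q c).toHom).length ≤ 6 at hlen
  change (w.map (placeCopyEmbedding p q c).toHom).length = 5 ∧
    ∃ v ∈ (w.map (placeCopyEmbedding p q c).toHom).support, v.IsGreen
  obtain ⟨h5, v, hv, hg⟩ := forcingGadget_isCycle w hw.of_map (by simpa using hlen)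
  refine ⟨by simpa using h5, placeCopy p q c v, ?_, ?_⟩
  · rw [SimpleGraph.Walk.support_map]
    exact List.mem_map_of_mem hv
  · rcases v with _ | v
    · exact hg.elim
    · exact .inr hg

theorem cycleGraph_free_fullGraph {n : ℕ} (h3 : 3 ≤ n) (h6 : n ≤ 6) (h5 : n ≠ 5) :
    (SimpleGraph.cycleGraph n).Free fullGraph := by
  intro h
  obtain ⟨v, w, hw, rfl⟩ := (SimpleGraph.cycleGraph_isContained_iff (by omega)).1 h
  exact h5 (fullGraph_isCycle w hw h6).1

/-- The vertices of a cycle of the reduced gadget. -/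
def gadgetCycle : Fin 7 → GadgetVertex := ![.terminal false, .inner (.white false 0),
  .inner (.big false 0), .inner (.red 0 0 false), .inner (.red 0 0 true), .inner (.big false 1),
  .inner (.white false 1)]

theorem gadgetCycle_adj (i : Fin 7) : forcingGadget.Adj (gadgetCycle i) (gadgetCycle (i + 1)) := by
  fin_cases i <;> simp [forcingGadget_adj, gadgetRel, gadgetCycle, redEnd]

theorem not_isGreen_gadgetCycle : ∀ i, ¬ (gadgetCycle i).IsGreen := by decide

theorem gadgetCycle_injective : Function.Injective gadgetCycle := by decide

theorem cycleGraph_isContained_reducedGraph :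
    (SimpleGraph.cycleGraph 7).IsContained reducedGraph := by
  have h0 : ¬ (5 : Fin 7) ≤ 0 := by decide
  have hsucc : ∀ i : Fin 7, reducedGadget.Adj ⟨gadgetCycle i, not_isGreen_gadgetCycle i⟩
    ⟨gadgetCycle (i + 1), not_isGreen_gadgetCycle (i + 1)⟩ := gadgetCycle_adj
  refine ⟨⟨(reducedPlaceCopy false false h0).comp
    ⟨fun i => ⟨gadgetCycle i, not_isGreen_gadgetCycle i⟩, fun {i j} h => ?_⟩, ?_⟩⟩
  · obtain h | h := SimpleGraph.cycleGraph_adj.1 h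
    · obtain rfl : i = j + 1 := by rw [← h]; abel
      exact (hsucc j).symm
    · obtain rfl : j = i + 1 := by rw [← h]; abel
      exact hsucc i
  · intro i j h
    exact gadgetCycle_injective (placeCopy_injective _ _ _ (congrArg Subtype.val h))

/-- A shorter cycle would be one of the full construction and so contain a green vertex;
`gadgetCycle` attains the bound. -/
theorem egirth_reducedGraph : reducedGraph.egirth = 7 := by
  apply le_antisymm
  · obtain ⟨v, w, hw, h7⟩ := (SimpleGraph.cycleGraph_isContained_iff (by omega)).1
      cycleGraph_isContained_reducedGraph
    simpa [h7] using SimpleGraph.egirth_le_length hw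
  · rw [SimpleGraph.le_egirth]
    intro a w hw
    by_contra! hlt
    have hlt : w.length < 7 := by exact_mod_cast hlt
    let f : reducedGraph ↪g fullGraph := SimpleGraph.Embedding.induce _
    obtain ⟨-, v, hv, hg⟩ := fullGraph_isCycle (w.map f.toHom) (hw.map f.injective)
      (by rw [SimpleGraph.Walk.length_map]; omega)
    rw [SimpleGraph.Walk.support_map, List.mem_map] at hv
    obtain ⟨u, -, rfl⟩ := hv
    exact u.2 hg

/-! ### Plane drawings -/

/-- A drawing given by a family of curves that contains all edges of a graph. -/
theorem isPlanarGraph_of_curves {V E : Type*} (G : SimpleGraph V) (pos : V → ℝ × ℝ)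
    (hpos : Function.Injective pos) (ends : E → Bool → V) (γ : E → unitInterval → ℝ × ℝ)
    (hends : ∀ u v, G.Adj u v → ∃ i, s(u, v) = s(ends i false, ends i true))
    (hvert : ∀ v, ∃ i b, ends i b = v)
    (hcont : ∀ i, Continuous (γ i)) (hinj : ∀ i, Function.Injective (γ i))
    (h0 : ∀ i, γ i 0 = pos (ends i false)) (h1 : ∀ i, γ i 1 = pos (ends i true))
    (hdisj : ∀ i j, i ≠ j → ∀ s t, γ i s = γ j t →
      ∃ b b', ends i b = ends j b' ∧ γ i s = pos (ends i b)) : IsPlanarGraph G := by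
  classical
  have hrep : ∀ e : Sym2 V, ∃ i, e ∈ G.edgeSet → e = s(ends i false, ends i true) := by
    intro e
    by_cases he : e ∈ G.edgeSet
    · induction e with
      | _ u v =>
        obtain ⟨i, hi⟩ := hends u v he
        exact ⟨i, fun _ => hi⟩
    · obtain ⟨i, -⟩ := hvert e.out.1
      exact ⟨i, fun h => (he h).elim⟩
  choose r hr using hrep
  have hmem : ∀ e ∈ G.edgeSet, ∀ b, ends (r e) b ∈ e := by
    intro e he b
    have : ends (r e) b ∈ s(ends (r e) false, ends (r e) true) := by cases b <;> simp
    rwa [← hr e he] at this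
  have hposmem : ∀ i b, pos (ends i b) ∈ Set.range (γ i) := by
    rintro i (_ | _)
    · exact ⟨0, h0 i⟩
    · exact ⟨1, h1 i⟩
  refine ⟨pos, fun e => Set.range (γ (r e)), hpos, ?_, ?_, ?_⟩
  · intro u v huv
    obtain ⟨hu, hv⟩ | ⟨hu, hv⟩ := Sym2.eq_iff.1 (hr _ (G.mem_edgeSet.2 huv))
    · exact ⟨γ _, hcont _, hinj _, by rw [h0, ← hu], by rw [h1, ← hv], rfl⟩
    · refine ⟨γ (r s(u, v)) ∘ unitInterval.symm, (hcont _).comp unitInterval.continuous_symm,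
        (hinj _).comp unitInterval.symm_bijective.injective, ?_, ?_, ?_⟩
      · rw [Function.comp, unitInterval.symm_zero, h1, ← hu]
      · rw [Function.comp, unitInterval.symm_one, h0, ← hv]
      · exact unitInterval.symm_bijective.surjective.range_comp _
  -- Every vertex is an end of some curve, so a vertex on an arc is a meeting point of two curves
  -- unless that curve is the arc itself.
  · rintro e he w ⟨s, hs⟩
    obtain ⟨i, b, rfl⟩ := hvert w
    by_cases hi : r e = i
    · subst hi
      exact hmem e he b
    · obtain ⟨t, ht⟩ := hposmem i b
      obtain ⟨c, c', -, hc⟩ := hdisj _ _ hi s t (hs.trans ht.symm)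
      rw [hpos (hs.symm.trans hc)]
      exact hmem e he c
  · rintro e he f hf hef z ⟨⟨s, hs⟩, ⟨t, ht⟩⟩
    have hne : r e ≠ r f := fun h => hef (by rw [hr e he, hr f hf, h])
    obtain ⟨b, b', hb, hz⟩ := hdisj _ _ hne s t (hs.trans ht.symm)
    exact ⟨ends (r e) b, ⟨hmem e he b, hb ▸ hmem f hf b'⟩, hz.symm.trans hs⟩

/-- Planarity is inherited by subgraphs. -/
theorem IsPlanarGraph.comap {V W : Type*} {G : SimpleGraph V} {H : SimpleGraph W}
    (hH : IsPlanarGraph H) (f : G →g H) (hf : Function.Injective f) : IsPlanarGraph G := by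
  obtain ⟨pos, arc, hpos, harc, hvert, hdisj⟩ := hH
  have hedge : ∀ e ∈ G.edgeSet, e.map f ∈ H.edgeSet := fun e he => f.map_mem_edgeSet he
  refine ⟨pos ∘ f, arc ∘ Sym2.map f, hpos.comp hf, fun u v h => harc _ _ (f.map_adj h), ?_, ?_⟩
  · intro e he w hw
    obtain ⟨a, ha, haw⟩ := Sym2.mem_map.1 (hvert _ (hedge e he) _ hw)
    exact hf haw ▸ ha
  · intro e he e' he' hne z hz
    obtain ⟨w, ⟨hw, hw'⟩, rfl⟩ := hdisj _ (hedge e he) _ (hedge e' he')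
      ((Sym2.map.injective hf).ne hne) hz
    obtain ⟨a, ha, rfl⟩ := Sym2.mem_map.1 hw
    obtain ⟨b, hb, hba⟩ := Sym2.mem_map.1 hw'
    exact ⟨a, ⟨ha, hf hba ▸ hb⟩, rfl⟩

/-! ### Segments with integral ends -/

/-- The point of parameter `t` on the segment from `P` to `Q`. -/
def segPoint (P Q : ℤ × ℤ) (t : ℝ) : ℝ × ℝ :=
  (P.1 + t * (Q.1 - P.1), P.2 + t * (Q.2 - P.2))

/-- The orientation of the triangle `PQR`, twice its signed area. -/
def orient (P Q R : ℤ × ℤ) : ℤ :=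
  (Q.1 - P.1) * (R.2 - P.2) - (Q.2 - P.2) * (R.1 - P.1)

/-- The segment `RS` lies strictly on one side of the line `PQ`, or one of its ends is an end of
`PQ` and the other one is not on that line. -/
def OneSide (P Q R S : ℤ × ℤ) : Prop :=
  0 < orient P Q R * orient P Q S ∨ (orient P Q S ≠ 0 ∧ (R = P ∨ R = Q)) ∨
    (orient P Q R ≠ 0 ∧ (S = P ∨ S = Q))

instance (P Q R S : ℤ × ℤ) : Decidable (OneSide P Q R S) := by
  unfold OneSide
  infer_instance

/-- The function `orient P Q` is affine along `RS` and vanishes on the whole line `PQ`, so `s` needs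
no bounds. -/
theorem OneSide.eq_of_segPoint_eq {P Q R S : ℤ × ℤ} (h : OneSide P Q R S) {s t : ℝ} (ht0 : 0 ≤ t)
    (ht1 : t ≤ 1) (heq : segPoint P Q s = segPoint R S t) :
    (t = 0 ∧ (R = P ∨ R = Q)) ∨ (t = 1 ∧ (S = P ∨ S = Q)) := by
  obtain ⟨e1, e2⟩ := Prod.ext_iff.1 heq
  simp only [segPoint] at e1 e2
  have key : (1 - t) * (orient P Q R : ℝ) + t * (orient P Q S : ℝ) = 0 := by
    simp only [orient]
    push_cast
    linear_combination ((Q.2 : ℝ) - P.2) * e1 - ((Q.1 : ℝ) - P.1) * e2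
  have hself : ∀ T, T = P ∨ T = Q → orient P Q T = 0 := by
    rintro T (rfl | rfl) <;> simp only [orient] <;> ring
  obtain h | ⟨hS, hR⟩ | ⟨hR, hS⟩ := h
  · exfalso
    have h' : (0 : ℝ) < orient P Q R * orient P Q S := by exact_mod_cast h
    have h2 : (orient P Q R : ℝ) * ((1 - t) * orient P Q R + t * orient P Q S) = 0 := by
      rw [key, mul_zero]
    have hR : (0 : ℝ) < (orient P Q R : ℝ) ^ 2 := by
      have : (orient P Q R : ℝ) ≠ 0 := left_ne_zero_of_mul h'.ne'
      positivity
    rcases ht0.eq_or_lt with rfl | ht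
    · nlinarith
    · nlinarith [mul_pos ht h', mul_nonneg (sub_nonneg.2 ht1) hR.le]
  · have hS' : (orient P Q S : ℝ) ≠ 0 := by exact_mod_cast hS
    rw [hself R hR, Int.cast_zero, mul_zero, zero_add] at key
    exact .inl ⟨(mul_eq_zero.1 key).resolve_right hS', hR⟩
  · have hR' : (orient P Q R : ℝ) ≠ 0 := by exact_mod_cast hR
    rw [hself S hS, Int.cast_zero, mul_zero, add_zero] at key
    exact .inr ⟨(sub_eq_zero.1 ((mul_eq_zero.1 key).resolve_right hR')).symm, hS⟩

/-! ### The drawing of the gadget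

The gadget is drawn in the strip `[0, 40] × (0, 42)`, all points of whose vertical sides stand for
the terminals. -/

/-- The edges of the gadget. -/
inductive GadgetEdge : Type
  | terminalWhite (s : Bool) (i : Fin 4)
  | whiteBig (s : Bool) (i : Fin 4)
  | bigBig (i : Fin 4)
  | bigRed (j : Fin 3) (m : Fin 3) (e : Bool)
  | redRed (j : Fin 3) (m : Fin 3)
  | terminalGreen (s : Bool) (i : Fin 4)
  | greenGreen (s : Bool) (i : Fin 4)
  | greenBig (s : Bool) (i : Fin 4)
  deriving DecidableEq, Fintype

/-- The two ends of an edge of the gadget. -/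
def GadgetEdge.ends : GadgetEdge → Bool → GadgetVertex
  | .terminalWhite s i, b => if b then .inner (.white s i) else .terminal s
  | .whiteBig s i, b => if b then .inner (.big s i) else .inner (.white s i)
  | .bigBig i, b => .inner (.big b i)
  | .bigRed j m e, b =>
      if b then .inner (.red j m e) else .inner (.big (redEnd j m e).1 (redEnd j m e).2)
  | .redRed j m, b => .inner (.red j m b)
  | .terminalGreen s i, b => if b then .inner (.greenWhite s i) else .terminal s
  | .greenGreen s i, b => if b then .inner (.greenNbr s i) else .inner (.greenWhite s i)
  | .greenBig s i, b => if b then .inner (.big s i) else .inner (.greenNbr s i)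

theorem exists_gadgetEdge {u v : GadgetVertex} (h : forcingGadget.Adj u v) :
    ∃ e : GadgetEdge, s(u, v) = s(e.ends false, e.ends true) := by
  wlog hrel : gadgetRel u v generalizing u v
  · obtain ⟨e, he⟩ := this h.symm (((forcingGadget_adj.1 h).2).resolve_left hrel)
    exact ⟨e, Sym2.eq_swap.trans he⟩
  rcases u with s | ⟨s, i⟩ | ⟨s, i⟩ | ⟨j, m, e⟩ | ⟨s, i⟩ | ⟨s, i⟩ <;>
  rcases v with s' | ⟨s', i'⟩ | ⟨s', i'⟩ | ⟨j', m', e'⟩ | ⟨s', i'⟩ | ⟨s', i'⟩ <;>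
  simp only [gadgetRel] at hrel
  · exact ⟨.terminalWhite s i', by subst hrel; rfl⟩
  · exact ⟨.terminalGreen s i', by subst hrel; rfl⟩
  · obtain ⟨rfl, rfl⟩ := hrel
    exact ⟨.whiteBig s i, rfl⟩
  · obtain ⟨hs, rfl⟩ := hrel
    refine ⟨.bigBig i, ?_⟩
    cases s <;> cases s' <;> first | exact (hs rfl).elim | rfl | exact Sym2.eq_swap
  · refine ⟨.bigRed j' m' e', ?_⟩
    simp only [GadgetEdge.ends, ← hrel]
    rfl
  · obtain ⟨rfl, rfl, he⟩ := hrel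
    refine ⟨.redRed j m, ?_⟩
    cases e <;> cases e' <;> first | exact (he rfl).elim | rfl | exact Sym2.eq_swap
  · obtain ⟨rfl, rfl⟩ := hrel
    exact ⟨.greenGreen s i, rfl⟩
  · obtain ⟨rfl, rfl⟩ := hrel
    exact ⟨.greenBig s i, rfl⟩

theorem exists_gadgetEdge_ends (v : GadgetInner) :
    ∃ (e : GadgetEdge) (b : Bool), e.ends b = .inner v := by
  rcases v with ⟨s, i⟩ | ⟨s, i⟩ | ⟨j, m, e⟩ | ⟨s, i⟩ | ⟨s, i⟩
  · exact ⟨.whiteBig s i, false, rfl⟩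
  · exact ⟨.bigBig i, s, rfl⟩
  · exact ⟨.redRed j m, e, rfl⟩
  · exact ⟨.greenGreen s i, false, rfl⟩
  · exact ⟨.greenGreen s i, true, rfl⟩

/-- The positions of the inner vertices in the strip. -/
def gadgetPos : GadgetInner → ℤ × ℤ
  | .white s i => (if s then 35 else 5, 10 * (i : ℕ) + if s then 7 else 6)
  | .big s i => (if s then 30 else 10, 10 * (i : ℕ) + 5)
  | .red j m e =>
      (if m = 0 then (if e then 12 else 11) else if m = 1 then (if e then 28 else 29)
        else (if e then 23 else 17),
       10 * (j : ℕ) + if e then 11 else if m = 2 then 8 else 9)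
  | .greenWhite s i => (if s then 37 else 3, 10 * (i : ℕ) + if s then 4 else 3)
  | .greenNbr s i => (if s then 34 else 6, 10 * (i : ℕ) + 2)

/-- The end points of the segment that represents an edge in the strip. -/
def GadgetEdge.pt (e : GadgetEdge) (b : Bool) : ℤ × ℤ :=
  match e.ends b, e.ends !b with
  | .inner v, _ => gadgetPos v
  -- Edges at a terminal are horizontal, each ending at its own point of the side. The last case is
  -- a default: no edge joins two terminals.
  | .terminal s, .inner v => (if s then 40 else 0, (gadgetPos v).2)
  | .terminal s, .terminal _ => (if s then 40 else 0, 0)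

theorem gadgetPos_injective : Function.Injective gadgetPos := by
  have : ∀ u v, gadgetPos u = gadgetPos v → u = v := by decide +kernel
  exact fun u v => this u v

theorem gadgetPos_mem : ∀ v, 0 < (gadgetPos v).1 ∧ (gadgetPos v).1 < 40 ∧
    0 < (gadgetPos v).2 ∧ (gadgetPos v).2 < 42 := by
  decide +kernel

namespace GadgetEdge

theorem pt_mem : ∀ (e : GadgetEdge) (b : Bool), 0 ≤ (e.pt b).1 ∧ (e.pt b).1 ≤ 40 ∧
    0 < (e.pt b).2 ∧ (e.pt b).2 < 42 := by
  decide +kernel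

/-- Since `drawCopy` preserves the abscissa up to a reflection and a shift, the absence of vertical
segments makes the curves injective. -/
theorem pt_fst_ne : ∀ e : GadgetEdge, (e.pt false).1 ≠ (e.pt true).1 := by
  decide +kernel

theorem ends_of_pt_fst : ∀ (e : GadgetEdge) (b : Bool),
    ((e.pt b).1 = 0 → e.ends b = .terminal false) ∧
    ((e.pt b).1 = 40 → e.ends b = .terminal true) := by
  decide +kernel

theorem pt_eq_of_ends {e : GadgetEdge} {b : Bool} {v : GadgetInner} (h : e.ends b = .inner v) :
    e.pt b = gadgetPos v := by
  rw [pt, h]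

theorem pt_fst_of_ends : ∀ (e : GadgetEdge) (b s : Bool), e.ends b = .terminal s →
    (e.pt b).1 = if s then 40 else 0 := by
  decide +kernel

theorem ends_eq_of_pt_eq : ∀ (e f : GadgetEdge) (b b' : Bool), e.pt b = f.pt b' →
    e.ends b = f.ends b' := by
  decide +kernel

theorem oneSide_or : ∀ e f : GadgetEdge, e ≠ f →
    OneSide (e.pt false) (e.pt true) (f.pt false) (f.pt true) ∨
    OneSide (f.pt false) (f.pt true) (e.pt false) (e.pt true) := by
  decide +kernel

end GadgetEdge

/-! ### The drawing of the full construction -/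

/-- The rectangle in which the inner vertices of the gadget are placed, with its vertical sides. -/
def InStrip (z : ℝ × ℝ) : Prop :=
  0 ≤ z.1 ∧ z.1 ≤ 40 ∧ 0 < z.2 ∧ z.2 < 42

theorem GadgetEdge.inStrip_segPoint (e : GadgetEdge) {t : ℝ} (h0 : 0 ≤ t) (h1 : t ≤ 1) :
    InStrip (segPoint (e.pt false) (e.pt true) t) := by
  obtain ⟨a1, a2, a3, a4⟩ := e.pt_mem false
  obtain ⟨b1, b2, b3, b4⟩ := e.pt_mem true
  have hc : ∀ x y : ℝ, x + t * (y - x) = (1 - t) * x + t * y := fun x y => by ring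
  have hs : 0 ≤ 1 - t := sub_nonneg.2 h1
  have a1' : (0 : ℝ) ≤ (e.pt false).1 := by exact_mod_cast a1
  have a2' : ((e.pt false).1 : ℝ) ≤ 40 := by exact_mod_cast a2
  -- Integrality turns the strict bounds into closed ones, which pass to convex combinations.
  have a3' : (1 : ℝ) ≤ (e.pt false).2 := by exact_mod_cast a3
  have a4' : ((e.pt false).2 : ℝ) ≤ 41 := by exact_mod_cast Int.le_of_lt_add_one a4
  have b1' : (0 : ℝ) ≤ (e.pt true).1 := by exact_mod_cast b1
  have b2' : ((e.pt true).1 : ℝ) ≤ 40 := by exact_mod_cast b2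
  have b3' : (1 : ℝ) ≤ (e.pt true).2 := by exact_mod_cast b3
  have b4' : ((e.pt true).2 : ℝ) ≤ 41 := by exact_mod_cast Int.le_of_lt_add_one b4
  simp only [InStrip, segPoint, hc]
  refine ⟨by positivity, ?_, ?_, ?_⟩
  · nlinarith [mul_le_mul_of_nonneg_left a2' hs, mul_le_mul_of_nonneg_left b2' h0]
  · nlinarith [mul_le_mul_of_nonneg_left a3' hs, mul_le_mul_of_nonneg_left b3' h0]
  · nlinarith [mul_le_mul_of_nonneg_left a4' hs, mul_le_mul_of_nonneg_left b4' h0]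

/-- On the segment of an edge only an end can lie on a vertical side of the strip. -/
theorem GadgetEdge.exists_end_of_segPoint_fst (e : GadgetEdge) {t : ℝ} (h0 : 0 ≤ t) (h1 : t ≤ 1)
    (s : Bool) (h : (segPoint (e.pt false) (e.pt true) t).1 = if s then 40 else 0) :
    ∃ b, e.ends b = .terminal s := by
  obtain ⟨a1, a2, -, -⟩ := e.pt_mem false
  obtain ⟨b1, b2, -, -⟩ := e.pt_mem true
  by_contra! hcon
  have key : ∀ b, (e.pt b).1 ≠ if s then 40 else 0 := by
    intro b hb
    cases s
    · exact hcon b ((e.ends_of_pt_fst b).1 hb)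
    · exact hcon b ((e.ends_of_pt_fst b).2 hb)
  have hc : ∀ x y : ℝ, x + t * (y - x) = (1 - t) * x + t * y := fun x y => by ring
  have hs : 0 ≤ 1 - t := sub_nonneg.2 h1
  have kf := key false
  have kt := key true
  simp only [segPoint, hc] at h
  cases s
  · simp only [Bool.false_eq_true, if_false] at h kf kt
    have a' : (1 : ℝ) ≤ (e.pt false).1 := by exact_mod_cast (show 1 ≤ (e.pt false).1 by omega)
    have b' : (1 : ℝ) ≤ (e.pt true).1 := by exact_mod_cast (show 1 ≤ (e.pt true).1 by omega)
    nlinarith [mul_le_mul_of_nonneg_left a' hs, mul_le_mul_of_nonneg_left b' h0]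
  · simp only [if_true] at h kf kt
    have a' : ((e.pt false).1 : ℝ) ≤ 39 := by exact_mod_cast (show (e.pt false).1 ≤ 39 by omega)
    have b' : ((e.pt true).1 : ℝ) ≤ 39 := by exact_mod_cast (show (e.pt true).1 ≤ 39 by omega)
    nlinarith [mul_le_mul_of_nonneg_left a' hs, mul_le_mul_of_nonneg_left b' h0]

theorem segPoint_zero (P Q : ℤ × ℤ) : segPoint P Q 0 = ((P.1 : ℝ), (P.2 : ℝ)) := by
  simp [segPoint]

theorem segPoint_one (P Q : ℤ × ℤ) : segPoint P Q 1 = ((Q.1 : ℝ), (Q.2 : ℝ)) := by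
  simp [segPoint]

/-- The segments of two edges of the gadget meet at most in a common end. -/
theorem GadgetEdge.exists_end_of_segPoint_eq {e f : GadgetEdge} (hne : e ≠ f) {s t : ℝ}
    (hs0 : 0 ≤ s) (hs1 : s ≤ 1) (ht0 : 0 ≤ t) (ht1 : t ≤ 1)
    (h : segPoint (e.pt false) (e.pt true) s = segPoint (f.pt false) (f.pt true) t) :
    ∃ b b', e.ends b = f.ends b' ∧
      segPoint (e.pt false) (e.pt true) s = (((e.pt b).1 : ℝ), ((e.pt b).2 : ℝ)) := by
  have key : ∃ b b', e.pt b = f.pt b' ∧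
      segPoint (e.pt false) (e.pt true) s = (((e.pt b).1 : ℝ), ((e.pt b).2 : ℝ)) := by
    rcases e.oneSide_or f hne with ho | ho
    · rw [h]
      obtain ⟨rfl, h | h⟩ | ⟨rfl, h | h⟩ := ho.eq_of_segPoint_eq ht0 ht1 h
      · exact ⟨false, false, h.symm, by rw [segPoint_zero, h]⟩
      · exact ⟨true, false, h.symm, by rw [segPoint_zero, h]⟩
      · exact ⟨false, true, h.symm, by rw [segPoint_one, h]⟩
      · exact ⟨true, true, h.symm, by rw [segPoint_one, h]⟩
    · obtain ⟨rfl, h | h⟩ | ⟨rfl, h | h⟩ := ho.eq_of_segPoint_eq hs0 hs1 h.symm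
      · exact ⟨false, false, h, segPoint_zero ..⟩
      · exact ⟨false, true, h, segPoint_zero ..⟩
      · exact ⟨true, false, h, segPoint_one ..⟩
      · exact ⟨true, true, h, segPoint_one ..⟩
  obtain ⟨b, b', hb, hz⟩ := key
  exact ⟨b, b', e.ends_eq_of_pt_eq f b b' hb, hz⟩

/-- The map of the strip to the plane that places a copy of the gadget. -/
def drawCopy (p q : Bool) (c : Fin 7) (z : ℝ × ℝ) : ℝ × ℝ :=
  -- The first coordinate determines `z.1`, and also `p` when `z.1 < 40`. Divided by `z.1 > 0`, the
  -- second one is 12000 or 24000 plus a term between 0 and 42 * 7 * 40 = 11760, which separates the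
  -- values of `q`; the factor 42, the height of the strip, then separates the copies. The sides
  -- collapse to the points `(±40, 0)` and `(0, 480000)` or `(0, 960000)`.
  ((if p then -1 else 1) * (40 - z.1),
    z.1 * (12000 * (if q then 2 else 1) + (42 * ((c : ℕ) : ℝ) + z.2) * (40 - z.1)))

/-- The maps `drawCopy` are injective and have disjoint images except for the vertical sides of the
strip. -/
theorem drawCopy_eq {p q p' q' : Bool} {c c' : Fin 7} {z z' : ℝ × ℝ} (hz : InStrip z)
    (hz' : InStrip z') (h : drawCopy p q c z = drawCopy p' q' c' z') :
    z.1 = z'.1 ∧ ((z.1 = 0 ∧ p = p') ∨ (z.1 = 40 ∧ q = q') ∨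
      (p = p' ∧ q = q' ∧ c = c' ∧ z = z')) := by
  obtain ⟨x, y⟩ := z
  obtain ⟨x', y'⟩ := z'
  obtain ⟨hx0, hx1, hy0, hy1⟩ := hz
  obtain ⟨hx0', hx1', hy0', hy1'⟩ := hz'
  simp only [drawCopy, Prod.mk.injEq] at h hx0 hx1 hy0 hy1 hx0' hx1' hy0' hy1' ⊢
  obtain ⟨h1, h2⟩ := h
  have hx : x = x' := by
    cases p <;> cases p' <;> simp at h1 <;> linarith
  subst hx
  refine ⟨rfl, ?_⟩
  have hp : x = 40 ∨ p = p' := by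
    cases p <;> cases p' <;> simp at h1 ⊢
    all_goals linarith
  by_cases hx40 : x = 40
  · refine .inr (.inl ⟨hx40, ?_⟩)
    subst hx40
    cases q <;> cases q' <;> first | rfl | norm_num at h2
  · have hp := hp.resolve_left hx40
    by_cases hx00 : x = 0
    · exact .inl ⟨hx00, hp⟩
    · refine .inr (.inr ?_)
      have h3 := mul_left_cancel₀ hx00 h2
      have hpos : 0 < 40 - x := sub_pos.2 (lt_of_le_of_ne hx1 hx40)
      have hcb : ∀ d : Fin 7, (0 : ℝ) ≤ ((d : ℕ) : ℝ) ∧ ((d : ℕ) : ℝ) ≤ 6 := fun d =>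
        ⟨Nat.cast_nonneg _, by exact_mod_cast Nat.le_of_lt_succ d.2⟩
      have hb : ∀ (d : Fin 7) (y : ℝ), 0 < y → y < 42 →
          0 < (42 * ((d : ℕ) : ℝ) + y) * (40 - x) ∧
            (42 * ((d : ℕ) : ℝ) + y) * (40 - x) < 12000 := by
        intro d y h0 h1
        obtain ⟨d0, d1⟩ := hcb d
        have hd : 0 < 42 * ((d : ℕ) : ℝ) + y := by linarith
        refine ⟨mul_pos hd hpos, ?_⟩
        nlinarith
      have b1 := hb c y hy0 hy1
      have b2 := hb c' y' hy0' hy1'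
      have hq : q = q' := by
        cases q <;> cases q' <;> simp at h3 ⊢ <;> linarith
      subst hq
      have h4 := mul_right_cancel₀ hpos.ne' (add_left_cancel h3)
      have hc : c = c' := by
        have l1 : (c : ℕ) < (c' : ℕ) + 1 := by
          have : ((c : ℕ) : ℝ) < ((c' : ℕ) : ℝ) + 1 := by linarith
          exact_mod_cast this
        have l2 : (c' : ℕ) < (c : ℕ) + 1 := by
          have : ((c' : ℕ) : ℝ) < ((c : ℕ) : ℝ) + 1 := by linarith
          exact_mod_cast this
        exact Fin.ext (by omega)
      subst hc
      exact ⟨hp, rfl, rfl, rfl, by linarith⟩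

/-- The positions of the vertices of the full construction. -/
def fullPos : FullVertex → ℝ × ℝ
  | .hub false p => ((if p then -1 else 1) * 40, 0)
  | .hub true q => (0, 480000 * (if q then 2 else 1))
  | .copy p q c v => drawCopy p q c (((gadgetPos v).1 : ℝ), ((gadgetPos v).2 : ℝ))

theorem drawCopy_fst_zero (p q : Bool) (c : Fin 7) {z : ℝ × ℝ} (h : z.1 = 0) :
    drawCopy p q c z = fullPos (.hub false p) := by
  simp [drawCopy, fullPos, h]

theorem drawCopy_fst_forty (p q : Bool) (c : Fin 7) {z : ℝ × ℝ} (h : z.1 = 40) :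
    drawCopy p q c z = fullPos (.hub true q) := by
  simp only [drawCopy, fullPos, h, sub_self, mul_zero, add_zero, Prod.mk.injEq, true_and]
  ring

theorem drawCopy_pt (p q : Bool) (c : Fin 7) (e : GadgetEdge) (b : Bool) :
    drawCopy p q c (((e.pt b).1 : ℝ), ((e.pt b).2 : ℝ)) = fullPos (placeCopy p q c (e.ends b)) := by
  rcases h : e.ends b with (_ | _) | v
  · exact drawCopy_fst_zero p q c (by simp [e.pt_fst_of_ends b false h])
  · exact drawCopy_fst_forty p q c (by simp [e.pt_fst_of_ends b true h])
  · rw [GadgetEdge.pt_eq_of_ends h]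
    rfl

theorem inStrip_gadgetPos (v : GadgetInner) :
    InStrip (((gadgetPos v).1 : ℝ), ((gadgetPos v).2 : ℝ)) := by
  obtain ⟨h1, h2, h3, h4⟩ := gadgetPos_mem v
  simp only [InStrip]
  exact_mod_cast And.intro h1.le (And.intro h2.le (And.intro h3 h4))

theorem fullPos_hub_ne_copy (e r p q : Bool) (c : Fin 7) (v : GadgetInner) :
    fullPos (.hub e r) ≠ fullPos (.copy p q c v) := by
  obtain ⟨h1, h2, -, -⟩ := gadgetPos_mem v
  have hs := inStrip_gadgetPos v
  intro h
  cases e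
  -- The hub is the image of any point of its side; the height 1 is arbitrary.
  · have hz : InStrip ((0 : ℝ), (1 : ℝ)) := by norm_num [InStrip]
    have := (drawCopy_eq hz hs ((drawCopy_fst_zero r q c rfl).trans h)).1
    simp only at this
    exact h1.ne (by exact_mod_cast this)
  · have hz : InStrip ((40 : ℝ), (1 : ℝ)) := by norm_num [InStrip]
    have := (drawCopy_eq hz hs ((drawCopy_fst_forty p r c rfl).trans h)).1
    simp only at this
    exact h2.ne' (by exact_mod_cast this)

theorem fullPos_injective : Function.Injective fullPos := by
  rintro (⟨e, r⟩ | ⟨p, q, c, v⟩) (⟨e', r'⟩ | ⟨p', q', c', v'⟩) h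
  · cases e <;> cases e' <;> cases r <;> cases r' <;> first | rfl | norm_num [fullPos] at h
  · exact (fullPos_hub_ne_copy _ _ _ _ _ _ h).elim
  · exact (fullPos_hub_ne_copy _ _ _ _ _ _ h.symm).elim
  · obtain ⟨h1, h2, -, -⟩ := gadgetPos_mem v
    obtain ⟨-, ⟨h0, -⟩ | ⟨h0, -⟩ | ⟨rfl, rfl, rfl, h0⟩⟩ :=
      drawCopy_eq (inStrip_gadgetPos v) (inStrip_gadgetPos v') h
    · simp only at h0
      exact (h1.ne' (by exact_mod_cast h0)).elim
    · simp only at h0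
      exact (h2.ne (by exact_mod_cast h0)).elim
    · simp only [Prod.mk.injEq, Int.cast_inj] at h0
      rw [gadgetPos_injective (Prod.ext h0.1 h0.2)]

/-- The edges of the full construction. -/
inductive FullEdge : Type
  | hub (e : Bool)
  | copy (p q : Bool) (c : Fin 7) (e : GadgetEdge)

/-- The two ends of an edge of the full construction. -/
def FullEdge.ends : FullEdge → Bool → FullVertex
  | .hub e, b => .hub e b
  | .copy p q c e, b => placeCopy p q c (e.ends b)

/-- The curves that represent the edges of the full construction. -/
def FullEdge.curve : FullEdge → ℝ → ℝ × ℝ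
  | .hub e, t => if e then (0, 480000 * (1 + t)) else (40 - 80 * t, 0)
  | .copy p q c e, t => drawCopy p q c (segPoint (e.pt false) (e.pt true) t)

namespace FullEdge

theorem continuous_curve (e : FullEdge) : Continuous e.curve := by
  change Continuous fun t => e.curve t
  rcases e with (_ | _) | ⟨p, q, c, e⟩
  · simp only [curve, Bool.false_eq_true, if_false]
    fun_prop
  · simp only [curve, if_true]
    fun_prop
  · simp only [curve, drawCopy, segPoint]
    fun_prop

theorem curve_injOn (e : FullEdge) {s t : ℝ} (hs0 : 0 ≤ s) (hs1 : s ≤ 1) (ht0 : 0 ≤ t)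
    (ht1 : t ≤ 1) (h : e.curve s = e.curve t) : s = t := by
  rcases e with (_ | _) | ⟨p, q, c, e⟩
  · simpa [curve] using h
  · simpa [curve] using h
  · have h1 := (drawCopy_eq (e.inStrip_segPoint hs0 hs1) (e.inStrip_segPoint ht0 ht1) h).1
    have hne : ((e.pt true).1 : ℝ) - (e.pt false).1 ≠ 0 :=
      sub_ne_zero.2 (by exact_mod_cast e.pt_fst_ne.symm)
    exact mul_right_cancel₀ hne (add_left_cancel h1)

theorem curve_zero (e : FullEdge) : e.curve 0 = fullPos (e.ends false) := by
  rcases e with (_ | _) | ⟨p, q, c, e⟩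
  · simp [curve, ends, fullPos]
  · simp [curve, ends, fullPos]
  · simp only [curve, ends, segPoint_zero, drawCopy_pt]

theorem curve_one (e : FullEdge) : e.curve 1 = fullPos (e.ends true) := by
  rcases e with (_ | _) | ⟨p, q, c, e⟩
  · norm_num [curve, ends, fullPos]
  · norm_num [curve, ends, fullPos]
  · simp only [curve, ends, segPoint_one, drawCopy_pt]

/-- The curve of an edge in a copy of the gadget meets the two edges between hubs only in
terminals. -/
theorem exists_end_of_curve_hub_eq (r p q : Bool) (c : Fin 7) (e : GadgetEdge) {s t : ℝ}
    (ht0 : 0 ≤ t) (ht1 : t ≤ 1) (h : (hub r).curve s = (copy p q c e).curve t) :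
    ∃ b b', (hub r).ends b = (copy p q c e).ends b' ∧
      (hub r).curve s = fullPos ((hub r).ends b) := by
  obtain ⟨hx0, hx1, hy0, -⟩ := e.inStrip_segPoint ht0 ht1
  rw [h]
  -- One hub edge lies on the horizontal axis, which the image of the strip meets only for abscissa
  -- 0; the other lies on the vertical axis, met only for abscissa 40.
  have key : (segPoint (e.pt false) (e.pt true) t).1 = if r then 40 else 0 := by
    change (hub r).curve s = drawCopy p q c (segPoint (e.pt false) (e.pt true) t) at h
    generalize segPoint (e.pt false) (e.pt true) t = z at *
    cases r
    · have h2 := congrArg Prod.snd h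
      simp only [curve, drawCopy, Bool.false_eq_true, if_false] at h2 ⊢
      refine (mul_eq_zero.1 h2.symm).resolve_right (ne_of_gt ?_)
      have : 0 ≤ (42 * ((c : ℕ) : ℝ) + z.2) * (40 - z.1) :=
        mul_nonneg (by positivity) (sub_nonneg.2 hx1)
      cases q <;> simp <;> linarith
    · have h1 := congrArg Prod.fst h
      simp only [curve, drawCopy, if_true] at h1 ⊢
      cases p <;> simp at h1 <;> linarith
  obtain ⟨b', hb'⟩ := e.exists_end_of_segPoint_fst ht0 ht1 r key
  cases r
  · exact ⟨p, b', by simp [ends, hb', placeCopy], drawCopy_fst_zero p q c key⟩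
  · exact ⟨q, b', by simp [ends, hb', placeCopy], drawCopy_fst_forty p q c key⟩

/-- The curves of two edges meet at most in a common end. -/
theorem exists_end_of_curve_eq {e f : FullEdge} (hne : e ≠ f) {s t : ℝ}
    (hs0 : 0 ≤ s) (hs1 : s ≤ 1) (ht0 : 0 ≤ t) (ht1 : t ≤ 1) (h : e.curve s = f.curve t) :
    ∃ b b', e.ends b = f.ends b' ∧ e.curve s = fullPos (e.ends b) := by
  rcases e with r | ⟨p, q, c, e⟩ <;> rcases f with r' | ⟨p', q', c', f⟩
  · exfalso
    cases r <;> cases r'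
    · exact hne rfl
    · have := congrArg Prod.snd h
      simp only [curve, Bool.false_eq_true, if_false, if_true] at this
      linarith
    · have := congrArg Prod.snd h
      simp only [curve, Bool.false_eq_true, if_false, if_true] at this
      linarith
    · exact hne rfl
  · exact exists_end_of_curve_hub_eq r p' q' c' f ht0 ht1 h
  · obtain ⟨b, b', hb, hz⟩ := exists_end_of_curve_hub_eq r' p q c e hs0 hs1 h.symm
    exact ⟨b', b, hb.symm, by rw [h, hz, hb]⟩
  · obtain ⟨hx, ⟨h0, rfl⟩ | ⟨h0, rfl⟩ | ⟨rfl, rfl, rfl, hseg⟩⟩ :=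
      drawCopy_eq (e.inStrip_segPoint hs0 hs1) (f.inStrip_segPoint ht0 ht1) h
    · obtain ⟨b, hb⟩ := e.exists_end_of_segPoint_fst hs0 hs1 false h0
      obtain ⟨b', hb'⟩ := f.exists_end_of_segPoint_fst ht0 ht1 false (hx ▸ h0)
      refine ⟨b, b', by simp [ends, hb, hb', placeCopy], ?_⟩
      simp only [ends, hb]
      exact drawCopy_fst_zero p q c h0
    · obtain ⟨b, hb⟩ := e.exists_end_of_segPoint_fst hs0 hs1 true h0
      obtain ⟨b', hb'⟩ := f.exists_end_of_segPoint_fst ht0 ht1 true (hx ▸ h0)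
      refine ⟨b, b', by simp [ends, hb, hb', placeCopy], ?_⟩
      simp only [ends, hb]
      exact drawCopy_fst_forty p q c h0
    · obtain ⟨b, b', hb, hz⟩ := GadgetEdge.exists_end_of_segPoint_eq
        (fun hef => hne (by rw [hef])) hs0 hs1 ht0 ht1 hseg
      refine ⟨b, b', by simp [ends, hb], ?_⟩
      simp only [curve, ends, hz, drawCopy_pt]

end FullEdge

theorem isPlanarGraph_fullGraph : IsPlanarGraph fullGraph := by
  refine isPlanarGraph_of_curves fullGraph fullPos fullPos_injective FullEdge.ends
    (fun e t => e.curve t) ?_ ?_ (fun e => e.continuous_curve.comp continuous_subtype_val)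
    (fun e s t h => Subtype.ext (e.curve_injOn s.2.1 s.2.2 t.2.1 t.2.2 h)) FullEdge.curve_zero
    FullEdge.curve_one
    (fun e f hne s t h => FullEdge.exists_end_of_curve_eq hne s.2.1 s.2.2 t.2.1 t.2.2 h)
  · intro u v h
    obtain ⟨e, p, rfl, rfl⟩ | ⟨p, q, c, a, b, hab, rfl, rfl⟩ := fullGraph_adj_iff.1 h
    · refine ⟨.hub e, ?_⟩
      cases p
      · rfl
      · exact Sym2.eq_swap
    · obtain ⟨e, he⟩ := exists_gadgetEdge hab
      exact ⟨.copy p q c e, congrArg (Sym2.map (placeCopy p q c)) he⟩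
  · rintro (⟨e, p⟩ | ⟨p, q, c, v⟩)
    · exact ⟨.hub e, p, rfl⟩
    · obtain ⟨e, b, hb⟩ := exists_gadgetEdge_ends v
      exact ⟨.copy p q c e, b, by rw [FullEdge.ends, hb]; rfl⟩

theorem isPlanarGraph_reducedGraph : IsPlanarGraph reducedGraph :=
  isPlanarGraph_fullGraph.comap (SimpleGraph.Embedding.induce _).toHom
    (SimpleGraph.Embedding.induce (G := fullGraph) _).injective

theorem mainTheorem4 :
    (∀ A : Set GadgetVertex, IsDefectiveColoring forcingGadget 0 3 A →
      ∃ (s : Bool) (v : GadgetVertex), forcingGadget.Adj (.terminal s) v ∧ v ∉ A) ∧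
    InClassC fullGraph ∧
    ¬ IsDefectiveColorable fullGraph 0 3 ∧
    (∀ A : Set {v : GadgetVertex // ¬ v.IsGreen}, IsDefectiveColoring reducedGadget 0 2 A →
      ∃ (s : Bool) (v : {v : GadgetVertex // ¬ v.IsGreen}),
        forcingGadget.Adj (.terminal s) v ∧ v ∉ A) ∧
    IsPlanarGraph reducedGraph ∧
    reducedGraph.egirth = 7 ∧
    Nat.card {v : FullVertex // ¬ v.IsGreen} = 684 ∧
    ¬ IsDefectiveColorable reducedGraph 0 2 := by
  exact ⟨forcingGadget_coloring,
    ⟨isPlanarGraph_fullGraph, cycleGraph_free_fullGraph (by norm_num) (by norm_num) (by norm_num),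
      cycleGraph_free_fullGraph (by norm_num) (by norm_num) (by norm_num),
      cycleGraph_free_fullGraph (by norm_num) (by norm_num) (by norm_num)⟩,
    not_isDefectiveColorable_fullGraph, reducedGadget_coloring, isPlanarGraph_reducedGraph,
    egirth_reducedGraph, card_reducedGraph, not_isDefectiveColorable_reducedGraph⟩
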